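/- Let $G$ be a finite simple graph with linearly ordered vertex set $V(G)$. Let $\mathcal C^\bullet(G)$ be the algebra of skew-commuting real polynomials (the exterior algebra) in the variables $x_i^*$ ($i\in V(G)$) and $x_{i,j}^*$ ($\{i,j\}\in E(G)$, $i<j$), graded by the number of variables, with the differential $Q$ given by the odd derivation such that $Q(x_i^*)=0$ and $Q(x_{i,j}^*)=x_i^*x_j^*$ for $i<j$; this is the Chevalley--Eilenberg complex of the Dani--Mainkar Lie algebra of $G$. Let $\mathcal C^\bullet(G,V(G))$ be the subcomplex spanned by the non-constant monomials in which every vertex of $G$ occurs, where $i$ occurs in $x_i^*$ and $i,j$ occur in $x_{i,j}^*$. The essential cohomology of $G$ is $\mathcal H^n(G)=H^n(\mathcal C^\bullet(G,V(G)))$, and $\beta_n(G)=\dim_{\mathbb R}\mathcal H^n(G)$. For $r\ge 0$, let $\beta_{n,r}(G)$ be the dimension of $H^n(\mathcal C^\bullet_{n+r}(G,V(G)))$, where $\mathcal C^\bullet_N(G,V(G))\subseteq \mathcal C^\bullet(G,V(G))$ is the subcomplex spanned by the monomials in $p$ variables $x_i^*$ and $q$ variables $x_{i,j}^*$ with $p+2q=N$.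 Let $S_n$ be the star graph with vertices $1,\ldots,n+1$ and edges $\{1,2\},\ldots,\{1,n+1\}$. Lemma. For every $n>0$, $$\beta_n(S_n)=\binom{n}{\lfloor n/2\rfloor}-1 .$$ Moreover, for every $n>0$: $\beta_{n,0}(S_n)=0$; $\beta_{n,1}(S_n)=n-1$; $\beta_{n,r}(S_n)=\beta_{n-1,r}(S_{n-1})+\beta_{n-1,r-1}(S_{n-1})$ for all integers $r$ with $1<r\le n/2$; and $\beta_{n,r}(S_n)=0$ for all $r>n/2$. -/

import Mathlib

noncomputable section

namespace DaniMainkar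

variable {V : Type*} [LinearOrder V]

/-- The (oriented) edges `i < j` of a graph `G` on a linearly ordered vertex set: every edge
`{i, j}` of `G` is represented exactly once. -/
abbrev OEdge (G : SimpleGraph V) : Type _ := {p : V × V // p.1 < p.2 ∧ G.Adj p.1 p.2}

/-- The indices of the variables of the cochain complex: the vertices `i` of `G` (variables
`x_i^*`) and the edges `{i, j}`, `i < j`, of `G` (variables `x_{i,j}^*`). They also index the
standard basis `x_i`, `x_{i,j}` of the Dani-Mainkar Lie algebra of `G`. -/
abbrev Gen (G : SimpleGraph V) : Type _ := V ⊕ OEdge G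

/-- The graded-commutative algebra of skew-commuting real polynomials in the variables `x_i^*`,
`x_{i,j}^*`, that is, the exterior algebra of the real vector space with these variables as a
basis (the dual of the Dani-Mainkar Lie algebra when `G` is finite). -/
abbrev Cochains (G : SimpleGraph V) : Type _ := ExteriorAlgebra ℝ (Gen G →₀ ℝ)

variable (G : SimpleGraph V)

/-- The variable with index `g`, as an element of the algebra. -/
def X (g : Gen G) : Cochains G := ExteriorAlgebra.ι ℝ (Finsupp.single g 1)

/-- The values of the differential on the variables: `x_i^* ↦ 0` and
`x_{i,j}^* ↦ x_i^* x_j^*` for `i < j`. -/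
def dGen : Gen G → Cochains G
  | Sum.inl _ => 0
  | Sum.inr e => X G (Sum.inl e.1.1) * X G (Sum.inl e.1.2)

/-- The linear extension of `dGen` to linear polynomials. -/
def dLin : (Gen G →₀ ℝ) →ₗ[ℝ] Cochains G := Finsupp.linearCombination ℝ (dGen G)

theorem ι_anticomm (a b : Gen G →₀ ℝ) :
    (ExteriorAlgebra.ι ℝ a : Cochains G) * ExteriorAlgebra.ι ℝ b
      = -(ExteriorAlgebra.ι ℝ b * ExteriorAlgebra.ι ℝ a) :=
  eq_neg_of_add_eq_zero_left (ExteriorAlgebra.ι_add_mul_swap a b)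

theorem dGen_commute (m : Gen G →₀ ℝ) (g : Gen G) :
    dGen G g * ExteriorAlgebra.ι ℝ m = ExteriorAlgebra.ι ℝ m * dGen G g := by
  cases g with
  | inl i => simp [dGen]
  | inr e =>
    simp only [dGen, X]
    rw [mul_assoc, ι_anticomm G _ m, mul_neg, ← mul_assoc, ι_anticomm G _ m, neg_mul, neg_neg,
      mul_assoc]

theorem dLin_commute (m m' : Gen G →₀ ℝ) :
    dLin G m' * ExteriorAlgebra.ι ℝ m = ExteriorAlgebra.ι ℝ m * dLin G m' := by
  induction m' using Finsupp.induction_linear with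
  | zero => simp
  | add f g hf hg => rw [map_add, add_mul, mul_add, hf, hg]
  | single g c => simp [dLin, dGen_commute]

/-- The linear map `m ↦ !![-m, d m; 0, m]`, whose values have square zero. -/
def triLin : (Gen G →₀ ℝ) →ₗ[ℝ] Matrix (Fin 2) (Fin 2) (Cochains G) where
  toFun m := !![-ExteriorAlgebra.ι ℝ m, dLin G m; 0, ExteriorAlgebra.ι ℝ m]
  map_add' a b := by
    ext i j; fin_cases i <;> fin_cases j <;> simp [add_comm]
  map_smul' c a := by
    ext i j; fin_cases i <;> fin_cases j <;> simp

theorem triLin_sq (m : Gen G →₀ ℝ) : triLin G m * triLin G m = 0 := by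
  ext i j
  fin_cases i <;> fin_cases j <;> simp [triLin, Matrix.mul_apply, dLin_commute]

/-- The algebra homomorphism `a ↦ !![ā, Q a; 0, a]`, where `ā = (-1)^{deg a} a`; multiplicativity
of this map is the graded Leibniz rule for `Q`. -/
def triHom : Cochains G →ₐ[ℝ] Matrix (Fin 2) (Fin 2) (Cochains G) :=
  ExteriorAlgebra.lift ℝ ⟨triLin G, triLin_sq G⟩

/-- The differential `Q`: the odd derivation with `Q x_i^* = 0` and `Q x_{i,j}^* = x_i^* x_j^*`
for `i < j` (see `Q_X_inl`, `Q_X_inr`, `Q_mul`; also `Q_Q`). -/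
def Q : Cochains G →ₗ[ℝ] Cochains G :=
  (Matrix.entryLinearMap ℝ (Cochains G) (0 : Fin 2) (1 : Fin 2)) ∘ₗ (triHom G).toLinearMap

theorem triHom_ι (m : Gen G →₀ ℝ) : triHom G (ExteriorAlgebra.ι ℝ m) = triLin G m := by
  simp [triHom]

theorem Q_ι (m : Gen G →₀ ℝ) : Q G (ExteriorAlgebra.ι ℝ m) = dLin G m := by
  simp [Q, triHom_ι, triLin]

theorem Q_X (g : Gen G) : Q G (X G g) = dGen G g := by
  simp [X, Q_ι, dLin]

theorem Q_X_inl (i : V) : Q G (X G (Sum.inl i)) = 0 := by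
  rw [Q_X]; rfl

theorem Q_X_inr (e : OEdge G) :
    Q G (X G (Sum.inr e)) = X G (Sum.inl e.1.1) * X G (Sum.inl e.1.2) := by
  rw [Q_X]; rfl

theorem triHom_entries (a : Cochains G) :
    triHom G a 0 0 = CliffordAlgebra.involute a ∧ triHom G a 1 0 = 0 ∧ triHom G a 1 1 = a := by
  induction a using ExteriorAlgebra.induction with
  | algebraMap r =>
    simp [AlgHom.commutes, Matrix.algebraMap_matrix_apply]
  | ι m =>
    refine ⟨?_, ?_, ?_⟩
    · rw [triHom_ι]
      exact (CliffordAlgebra.involute_ι m).symm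
    · simp [triHom_ι, triLin]
    · simp [triHom_ι, triLin]
  | mul a b ha hb =>
    simp [Matrix.mul_apply, ha, hb]
  | add a b ha hb =>
    simp [ha, hb]

/-- The graded Leibniz rule; `involute a = (-1)^{deg a} a` on homogeneous elements. -/
theorem Q_mul (a b : Cochains G) :
    Q G (a * b) = Q G a * b + CliffordAlgebra.involute a * Q G b := by
  have ha := triHom_entries G a
  have hb := triHom_entries G b
  simp [Q, Matrix.mul_apply, ha, hb, add_comm]

theorem Q_X_mul (g : Gen G) (a : Cochains G) :
    Q G (X G g * a) = dGen G g * a - X G g * Q G a := by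
  have h : CliffordAlgebra.involute (X G g) = -X G g := CliffordAlgebra.involute_ι _
  rw [Q_mul, Q_X, h, neg_mul, sub_eq_add_neg]

theorem Q_dLin (m : Gen G →₀ ℝ) : Q G (dLin G m) = 0 := by
  induction m using Finsupp.induction_linear with
  | zero => simp
  | add f g hf hg => rw [map_add, map_add, hf, hg, add_zero]
  | single g c =>
    cases g with
    | inl i => simp [dLin, dGen]
    | inr e => simp [dLin, dGen, Q_X_mul, Q_X_inl]

theorem Q_involute (a : Cochains G) :
    Q G (CliffordAlgebra.involute a) = -CliffordAlgebra.involute (Q G a) := by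
  have hd : ∀ m, CliffordAlgebra.involute (dLin G m) = dLin G m := by
    intro m
    induction m using Finsupp.induction_linear with
    | zero => simp
    | add f g hf hg => rw [map_add, map_add, hf, hg]
    | single g c =>
      have h : ∀ g, CliffordAlgebra.involute (X G g) = -X G g :=
        fun g => CliffordAlgebra.involute_ι _
      cases g with
      | inl i => simp [dLin, dGen]
      | inr e => simp [dLin, dGen, h]
  induction a using ExteriorAlgebra.induction with
  | algebraMap r =>
    have h1 : Q G 1 = 0 := by simpa using Q_mul G 1 1
    simp [Algebra.algebraMap_eq_smul_one, h1]
  | ι m =>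
    have h : CliffordAlgebra.involute (ExteriorAlgebra.ι ℝ m : Cochains G)
      = -ExteriorAlgebra.ι ℝ m := CliffordAlgebra.involute_ι _
    rw [h, map_neg, Q_ι, hd]
  | mul a b ha hb =>
    simp only [map_mul, Q_mul, ha, hb, map_add]
    rw [neg_mul, mul_neg, neg_add]
  | add a b ha hb => simp only [map_add, ha, hb, neg_add]

/-- `Q` is a differential. -/
theorem Q_Q (a : Cochains G) : Q G (Q G a) = 0 := by
  induction a using ExteriorAlgebra.induction with
  | algebraMap r =>
    have h1 : Q G 1 = 0 := by simpa using Q_mul G 1 1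
    simp [Algebra.algebraMap_eq_smul_one, h1]
  | ι m => rw [Q_ι, Q_dLin]
  | mul a b ha hb =>
    rw [Q_mul, map_add, Q_mul, Q_mul, ha, hb, Q_involute]
    simp
  | add a b ha hb => rw [map_add, map_add, ha, hb, add_zero]

/-- The vertices occurring in a variable: `i` in `x_i^*`, and `i`, `j` in `x_{i,j}^*`. -/
def genSupport : Gen G → Set V
  | Sum.inl i => {i}
  | Sum.inr e => {e.1.1, e.1.2}

/-- The weight of a variable: `1` for `x_i^*` and `2` for `x_{i,j}^*`. -/
def genWeight : Gen G → ℕ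
  | Sum.inl _ => 1
  | Sum.inr _ => 2

/-- The monomial which is the product of a list of variables. -/
def monomial (l : List (Gen G)) : Cochains G := (l.map (X G)).prod

/-- The set of vertices occurring in a monomial. -/
def support (l : List (Gen G)) : Set V := {v | ∃ g ∈ l, v ∈ genSupport G g}

/-- The weight `p + 2q` of a monomial in `p` vertex variables and `q` edge variables. -/
def weight (l : List (Gen G)) : ℕ := (l.map (genWeight G)).sum

/-- `C^n(G, S)`: the span of the monomials of degree `n` in which exactly the vertices in `S`
occur. The condition `l ≠ []` only implements the convention `C^•(G, ∅) = 0`. -/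
def C (S : Set V) (n : ℕ) : Submodule ℝ (Cochains G) :=
  Submodule.span ℝ {a | ∃ l : List (Gen G),
    l ≠ [] ∧ l.length = n ∧ support G l = S ∧ a = monomial G l}

/-- `C_N^n(G, S)`: the span of the monomials of degree `n` and weight `N` in which exactly the
vertices in `S` occur. -/
def CW (S : Set V) (N n : ℕ) : Submodule ℝ (Cochains G) :=
  Submodule.span ℝ {a | ∃ l : List (Gen G),
    l ≠ [] ∧ l.length = n ∧ support G l = S ∧ weight G l = N ∧ a = monomial G l}

theorem Q_monomial_mem (l : List (Gen G)) :
    Q G (monomial G l) ∈ CW G (support G l) (weight G l) (l.length + 1) := by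
  induction l with
  | nil =>
    have h1 : Q G 1 = 0 := by simpa using Q_mul G 1 1
    simp [monomial, h1]
  | cons g l ih =>
    have e : monomial G (g :: l) = X G g * monomial G l := by simp [monomial]
    rw [e, Q_X_mul]
    refine Submodule.sub_mem _ ?_ ?_
    · cases g with
      | inl i => simp [dGen]
      | inr p =>
        refine Submodule.subset_span
          ⟨Sum.inl p.1.1 :: Sum.inl p.1.2 :: l, by simp, by simp, ?_, ?_, ?_⟩
        · ext v
          simp [support, genSupport, or_assoc]
        · simp [weight, genWeight]
          omega
        · simp [monomial, dGen, mul_assoc]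
    · have key : CW G (support G l) (weight G l) (l.length + 1) ≤
          (CW G (support G (g :: l)) (weight G (g :: l)) ((g :: l).length + 1)).comap
            (LinearMap.mulLeft ℝ (X G g)) := by
        refine Submodule.span_le.2 ?_
        rintro _ ⟨l', -, h2, h3, h4, rfl⟩
        refine Submodule.subset_span ⟨g :: l', by simp, by simp [h2], ?_, ?_, ?_⟩
        · ext v
          have := Set.ext_iff.1 h3 v
          simp only [support, Set.mem_ofPred_eq, List.mem_cons, exists_eq_or_imp] at this ⊢
          rw [this]
        · simp only [weight, List.map_cons, List.sum_cons] at h4 ⊢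
          rw [h4]
        · simp [monomial]
      exact key ih

/-- `C_N^•(G, S)` is a subcomplex. -/
theorem Q_mem_CW (S : Set V) (N n : ℕ) {a : Cochains G} (ha : a ∈ CW G S N n) :
    Q G a ∈ CW G S N (n + 1) := by
  refine (Submodule.span_le (p := (CW G S N (n + 1)).comap (Q G))).2 ?_ ha
  rintro _ ⟨l, -, rfl, rfl, rfl, rfl⟩
  exact Q_monomial_mem G l

/-- `C^•(G, S)` is a subcomplex. -/
theorem Q_mem_C (S : Set V) (n : ℕ) {a : Cochains G} (ha : a ∈ C G S n) :
    Q G a ∈ C G S (n + 1) := by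
  refine (Submodule.span_le (p := (C G S (n + 1)).comap (Q G))).2 ?_ ha
  rintro _ ⟨l, -, rfl, rfl, rfl⟩
  refine Submodule.span_mono ?_ (Q_monomial_mem G l)
  rintro _ ⟨l', h1, h2, h3, -, rfl⟩
  exact ⟨l', h1, h2, h3, rfl⟩

/-- The degree `n` cocycles of the subcomplex of `Cochains G` with graded components `D`. -/
def cocycles (D : ℕ → Submodule ℝ (Cochains G)) (n : ℕ) : Submodule ℝ (Cochains G) :=
  D n ⊓ LinearMap.ker (Q G)

/-- The degree `n` coboundaries of the subcomplex of `Cochains G` with graded components `D`. -/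
def coboundaries (D : ℕ → Submodule ℝ (Cochains G)) : ℕ → Submodule ℝ (Cochains G)
  | 0 => ⊥
  | n + 1 => (D n).map (Q G)

/-- The degree `n` cohomology (cocycles modulo coboundaries) of the subcomplex of `Cochains G`
with graded components `D`. -/
abbrev Cohomology (D : ℕ → Submodule ℝ (Cochains G)) (n : ℕ) : Type _ :=
  cocycles G D n ⧸ (coboundaries G D n).submoduleOf (cocycles G D n)

/-- The essential cohomology `ℋ^n(G) = H^n(C^•(G, V(G)))`. -/
abbrev EssentialCohomology (n : ℕ) : Type _ := Cohomology G (C G Set.univ) n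

/-- `β_n(G)`, the dimension of `ℋ^n(G)`. -/
def beta (n : ℕ) : ℕ := Module.finrank ℝ (EssentialCohomology G n)

/-- The bigraded essential cohomology `ℋ^{n,r}(G) = H^n(C_{n+r}^•(G, V(G)))`. -/
abbrev BigradedEssentialCohomology (n r : ℕ) : Type _ := Cohomology G (CW G Set.univ (n + r)) n

/-- `β_{n,r}(G)`, the dimension of `ℋ^{n,r}(G)`. -/
def betaBi (n r : ℕ) : ℕ := Module.finrank ℝ (BigradedEssentialCohomology G n r)

/-- The star graph `S_n` on `n + 1` vertices, with the first vertex as its centre. -/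
abbrev star (n : ℕ) : SimpleGraph (Fin (n + 1)) := SimpleGraph.starGraph 0

end DaniMainkar

end

/-! A variable of the star graph covers at most one leaf, so no monomial of degree below `n` covers
all leaves. In degree `n` there are no coboundaries, and each leaf is covered exactly once: the
monomials are, up to sign, the `starMon S`, where `S` is the set of leaves covered by edges. The
centre is covered exactly when `S` is nonempty, and `n + #S` is the weight.

The differential sends `starMon S` to the sum of `center n * starMon (S.erase i)` over `i ∈ S`,
without signs, and the products `center n * starMon T` are linearly independent (`coneCoeff_apply`).
Hence the cocycles form the kernel of the lowering operator of the Boolean lattice on functions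
vanishing at `∅` (`finrank_cohomology_star`).

The commutation relation `down_up` with the raising operator makes `down` injective above the middle
rank (`kerHomog_eq_bot`) and surjective onto rank `r` if `2 * r < n` (`downHomog_surjective`). In
rank `r + 1` the kernel then has dimension `n.choose (r + 1) - n.choose r`. The sum over all ranks
telescopes, and the recursion is Pascal's rule. -/

noncomputable section

namespace BooleanLattice

open Finset

/-! ### Homogeneous functions on the Boolean lattice -/

/-- The functions supported on the sets of cardinality `r`. -/
def homog (α : Type*) (r : ℕ) : Submodule ℝ (Finset α → ℝ) where
  carrier := {f | ∀ S, #S ≠ r → f S = 0}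
  add_mem' hf hg S hS := by simp [hf S hS, hg S hS]
  zero_mem' _ _ := rfl
  smul_mem' c f hf S hS := by simp [hf S hS]

/-- The restriction of `f` to the sets of cardinality `r`, extended by zero. -/
def component {α : Type*} (r : ℕ) (f : Finset α → ℝ) : Finset α → ℝ := fun S => if #S = r then f S else 0

theorem component_mem_homog {α : Type*} (r : ℕ) (f : Finset α → ℝ) : component r f ∈ homog α r :=
  fun _ hS => if_neg hS

/-- Restriction to the sets of cardinality `r` identifies `homog α r` with the functions on these
sets. -/
def homogEquiv {α : Type*} (r : ℕ) : homog α r ≃ₗ[ℝ] ({S : Finset α // #S = r} → ℝ) where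
  toFun f S := f.1 S
  map_add' _ _ := rfl
  map_smul' _ _ := rfl
  invFun g := ⟨fun S => if h : #S = r then g ⟨S, h⟩ else 0, fun S hS => dif_neg hS⟩
  left_inv f := by
    ext S
    by_cases h : #S = r
    · simp [h]
    · simp [h, f.2 S h]
  right_inv g := by
    ext S
    simp [S.2]

theorem finrank_homog {α : Type*} [Fintype α] (r : ℕ) :
    Module.finrank ℝ (homog α r) = (Fintype.card α).choose r := by
  rw [(homogEquiv r).finrank_eq, Module.finrank_fintype_fun_eq_card, Fintype.card_finset_len]

theorem eq_zero_of_sum_sq {ι : Type*} [Fintype ι] {f : ι → ℝ} (h : ∑ S, f S * f S ≤ 0) : f = 0 := by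
  ext S
  have h0 := (sum_eq_zero_iff_of_nonneg fun S _ => mul_self_nonneg (f S)).1
    (le_antisymm h (sum_nonneg fun S _ => mul_self_nonneg (f S))) S (mem_univ S)
  exact mul_self_eq_zero.1 h0

/-! ### The lowering and raising operators -/

variable {α : Type*} [Fintype α] [DecidableEq α]

/-- The lowering operator on functions on the Boolean lattice; its value on the indicator function
of `S` is the sum of the indicator functions of the sets `S \ {i}`, `i ∈ S`. -/
def down : (Finset α → ℝ) →ₗ[ℝ] (Finset α → ℝ) where
  toFun f S := ∑ i, if i ∈ S then 0 else f (insert i S)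
  map_add' f g := by
    ext S
    simp only [Pi.add_apply, ← sum_add_distrib]
    exact sum_congr rfl fun i _ => by split_ifs <;> simp
  map_smul' c f := by
    ext S
    simp only [Pi.smul_apply, smul_eq_mul, mul_sum, RingHom.id_apply]
    exact sum_congr rfl fun i _ => by split_ifs <;> simp

/-- The raising operator on functions on the Boolean lattice, adjoint to `down`. -/
def up : (Finset α → ℝ) →ₗ[ℝ] (Finset α → ℝ) where
  toFun f S := ∑ i, if i ∈ S then f (S.erase i) else 0
  map_add' f g := by
    ext S
    simp only [Pi.add_apply, ← sum_add_distrib]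
    exact sum_congr rfl fun i _ => by split_ifs <;> simp
  map_smul' c f := by
    ext S
    simp only [Pi.smul_apply, smul_eq_mul, mul_sum, RingHom.id_apply]
    exact sum_congr rfl fun i _ => by split_ifs <;> simp

theorem down_apply (f : Finset α → ℝ) (S : Finset α) :
    down f S = ∑ i, if i ∈ S then 0 else f (insert i S) := rfl

theorem up_apply (f : Finset α → ℝ) (S : Finset α) :
    up f S = ∑ i, if i ∈ S then f (S.erase i) else 0 := rfl

/-- Adding `i` and removing `j ≠ i` commute, so only the diagonal terms differ: `down ∘ up` counts
`f S` once for each `i ∉ S`, and `up ∘ down` once for each `i ∈ S`. -/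
theorem down_up (f : Finset α → ℝ) (S : Finset α) :
    down (up f) S = up (down f) S + ((Fintype.card α : ℝ) - 2 * #S) * f S := by
  have key : ∀ i j : α,
      (if i ∈ S then 0 else if j ∈ insert i S then f ((insert i S).erase j) else 0) =
      (if j ∈ S then if i ∈ S.erase j then 0 else f (insert i (S.erase j)) else 0) +
        if i = j then (if i ∈ S then -f S else f S) else 0 := by
    intro i j
    rcases eq_or_ne i j with rfl | hij
    · by_cases hi : i ∈ S <;> simp [hi]
    · by_cases hi : i ∈ S <;> by_cases hj : j ∈ S <;>
        simp [hi, hj, hij, hij.symm, erase_insert_of_ne]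
  have hcount : ∑ i : α, (if i ∈ S then -f S else f S) =
      ((Fintype.card α : ℝ) - 2 * #S) * f S := by
    have : ∀ i : α, (if i ∈ S then -f S else f S) = f S - (if i ∈ S then 2 * f S else 0) := by
      intro i; split_ifs <;> ring
    simp only [this, sum_sub_distrib, sum_ite_mem, univ_inter, sum_const, card_univ, nsmul_eq_mul]
    ring
  have h1 : down (up f) S = ∑ i, ∑ j,
      (if i ∈ S then 0 else if j ∈ insert i S then f ((insert i S).erase j) else 0) := by
    rw [down_apply]
    refine sum_congr rfl fun i _ => ?_
    split_ifs
    · simp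
    · exact up_apply f _
  have h2 : up (down f) S = ∑ i, ∑ j,
      (if j ∈ S then if i ∈ S.erase j then 0 else f (insert i (S.erase j)) else 0) := by
    rw [up_apply, sum_comm]
    refine sum_congr rfl fun j _ => ?_
    split_ifs
    · exact down_apply f _
    · simp
  rw [h1, h2, ← hcount]
  simp only [key, sum_add_distrib, sum_ite_eq, mem_univ, if_true]

/-- Both sides run over the covering pairs of the lattice, indexed by the smaller or by the larger
set. -/
theorem sum_sum_insert {M : Type*} [AddCommMonoid M] (F : Finset α → Finset α → M) :
    ∑ S, ∑ i, (if i ∈ S then 0 else F S (insert i S)) =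
      ∑ S, ∑ i, if i ∈ S then F (S.erase i) S else 0 := by
  rw [sum_comm, sum_comm (s := univ (α := Finset α))]
  refine sum_congr rfl fun i _ => ?_
  have hnot : ∀ S : Finset α, (if i ∈ S then 0 else F S (insert i S)) =
      if i ∉ S then F S (insert i S) else 0 := fun S => (ite_not _ _ _).symm
  simp only [hnot]
  rw [← sum_filter, ← sum_filter]
  refine sum_bij' (fun S _ => insert i S) (fun S _ => S.erase i) ?_ ?_ ?_ ?_ ?_ <;>
    simp +contextual

theorem sum_mul_down (f g : Finset α → ℝ) : ∑ S, g S * down f S = ∑ S, up g S * f S := by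
  simp only [down_apply, up_apply, mul_sum, sum_mul, mul_ite, ite_mul, mul_zero, zero_mul]
  exact sum_sum_insert fun S T => g S * f T

theorem down_mem_homog {r : ℕ} {f : Finset α → ℝ} (hf : f ∈ homog α (r + 1)) :
    down f ∈ homog α r := by
  intro S hS
  refine sum_eq_zero fun i _ => ?_
  split_ifs with hi
  · rfl
  · exact hf _ (by rw [card_insert_of_notMem hi]; omega)

theorem up_mem_homog {r : ℕ} {f : Finset α → ℝ} (hf : f ∈ homog α r) :
    up f ∈ homog α (r + 1) := by
  intro S hS
  refine sum_eq_zero fun i _ => ?_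
  split_ifs with hi
  · exact hf _ fun h => hS (by rw [← h, card_erase_add_one hi])
  · rfl

/-- By adjointness, `down_up` becomes an identity of square norms, and the sign of `card α - 2 * r`
decides the injectivity results on either side of the middle rank. -/
theorem sum_up_sq {r : ℕ} {f : Finset α → ℝ} (hf : f ∈ homog α r) :
    ∑ S, up f S * up f S =
      ∑ S, down f S * down f S + ((Fintype.card α : ℝ) - 2 * r) * ∑ S, f S * f S := by
  have h1 := sum_mul_down (up f) f
  have h2 := sum_mul_down f (down f)
  rw [← h1, h2, mul_sum, ← sum_add_distrib]
  refine sum_congr rfl fun S _ => ?_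
  rw [down_up]
  by_cases hS : #S = r
  · rw [hS]; ring
  · rw [hf S hS]; ring

/-! ### Dimension of the kernel in each rank -/

/-- The kernel of the lowering operator on `homog α r`. -/
def kerHomog (α : Type*) [Fintype α] [DecidableEq α] (r : ℕ) : Submodule ℝ (Finset α → ℝ) :=
  homog α r ⊓ LinearMap.ker down

/-- If `down f = 0`, the square norm of `up f` is a negative multiple of that of `f`. -/
theorem kerHomog_eq_bot {r : ℕ} (hr : Fintype.card α < 2 * r) : kerHomog α r = ⊥ := by
  rw [eq_bot_iff]
  rintro f ⟨hf, hd⟩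
  have hd : down f = 0 := hd
  have h := sum_up_sq hf
  have h1 : 0 ≤ ∑ S, up f S * up f S := sum_nonneg fun S _ => mul_self_nonneg _
  have hr' : (Fintype.card α : ℝ) < 2 * r := by exact_mod_cast hr
  simp only [hd, Pi.zero_apply, mul_zero, sum_const_zero, zero_add] at h
  refine eq_zero_of_sum_sq (le_of_not_gt fun hpos => ?_)
  nlinarith

/-- The lowering operator as a map from functions of degree `r + 1` to functions of degree `r`. -/
def downHomog (α : Type*) [Fintype α] [DecidableEq α] (r : ℕ) :
    homog α (r + 1) →ₗ[ℝ] homog α r :=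
  down.restrict fun _ => down_mem_homog

/-- The raising operator as a map from functions of degree `r` to functions of degree `r + 1`. -/
def upHomog (α : Type*) [Fintype α] [DecidableEq α] (r : ℕ) :
    homog α r →ₗ[ℝ] homog α (r + 1) :=
  up.restrict fun _ => up_mem_homog

theorem downHomog_surjective {r : ℕ} (hr : 2 * r < Fintype.card α) :
    Function.Surjective (downHomog α r) := by
  -- An injective endomorphism in finite dimension is surjective, so it suffices to treat `down ∘
  -- up` on rank `r`. If it kills `f`, adjointness gives `up f` norm zero, and `sum_up_sq` with a
  -- positive coefficient forces `f = 0`.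
  have hinj : Function.Injective (downHomog α r ∘ₗ upHomog α r) := by
    rw [← LinearMap.ker_eq_bot, LinearMap.ker_eq_bot']
    rintro ⟨f, hf⟩ h0
    have hdu : down (up f) = 0 := congrArg Subtype.val h0
    have h1 := sum_mul_down (up f) f
    simp only [hdu, Pi.zero_apply, mul_zero, sum_const_zero] at h1
    have h := sum_up_sq hf
    have h2 : 0 ≤ ∑ S, down f S * down f S := sum_nonneg fun S _ => mul_self_nonneg _
    have hr' : (2 * r : ℝ) < Fintype.card α := by exact_mod_cast hr
    refine Subtype.ext (eq_zero_of_sum_sq (le_of_not_gt fun hpos => ?_))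
    nlinarith
  exact Function.Surjective.of_comp (LinearMap.injective_iff_surjective.1 hinj)

theorem finrank_kerHomog_eq_finrank_ker (r : ℕ) :
    Module.finrank ℝ (kerHomog α (r + 1)) =
      Module.finrank ℝ (LinearMap.ker (downHomog α r)) := by
  have : (LinearMap.ker (downHomog α r)).map (homog α (r + 1)).subtype = kerHomog α (r + 1) := by
    ext f
    constructor
    · rintro ⟨⟨f, hf⟩, hk, rfl⟩
      exact ⟨hf, congrArg Subtype.val hk⟩
    · rintro ⟨hf, hk⟩
      exact ⟨⟨f, hf⟩, Subtype.ext hk, rfl⟩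
  rw [← this]
  exact (Submodule.equivMapOfInjective _ (Submodule.subtype_injective _) _).finrank_eq.symm

theorem finrank_kerHomog_add {r : ℕ} (hr : 2 * r < Fintype.card α) :
    Module.finrank ℝ (kerHomog α (r + 1)) + (Fintype.card α).choose r =
      (Fintype.card α).choose (r + 1) := by
  have h := (downHomog α r).finrank_range_add_finrank_ker
  rw [LinearMap.range_eq_top.2 (downHomog_surjective hr), finrank_top, finrank_homog,
    finrank_homog] at h
  rw [finrank_kerHomog_eq_finrank_ker]
  omega

/-! ### The total kernel on functions vanishing at the empty set -/

/-- The kernel of the lowering operator on the functions vanishing at `∅`. -/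
def kerPos (α : Type*) [Fintype α] [DecidableEq α] : Submodule ℝ (Finset α → ℝ) :=
  LinearMap.ker (LinearMap.proj (R := ℝ) (φ := fun _ : Finset α => ℝ) ∅) ⊓ LinearMap.ker down

theorem down_component (r : ℕ) (f : Finset α → ℝ) :
    down (component (r + 1) f) = component r (down f) := by
  ext S
  by_cases hS : #S = r
  · simp only [component, hS, if_true, down_apply]
    refine sum_congr rfl fun i _ => ?_
    split_ifs with h1 h2
    · rfl
    · rfl
    · exact absurd (by rw [card_insert_of_notMem h1, hS]) h2
  · rw [down_mem_homog (component_mem_homog _ _) S hS, component, if_neg hS]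

/-- The decomposition of the kernel of the lowering operator into homogeneous components. -/
def kerPosEquiv (α : Type*) [Fintype α] [DecidableEq α] :
    kerPos α ≃ₗ[ℝ] (∀ r : Fin (Fintype.card α), kerHomog α (r + 1)) where
  toFun f r := ⟨component (r + 1) f.1, component_mem_homog _ _, by
    have hf : down f.1 = 0 := f.2.2
    change down _ = 0
    rw [down_component, hf]
    ext S
    simp [component]⟩
  map_add' f g := by
    ext r S
    by_cases h : #S = r + 1 <;> simp [component, h]
  map_smul' c f := by
    ext r S
    by_cases h : #S = r + 1 <;> simp [component, h]
  invFun g := ⟨∑ r, (g r).1, by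
    refine Submodule.sum_mem _ fun r _ => ⟨?_, (g r).2.2⟩
    exact (g r).2.1 ∅ (by simp)⟩
  left_inv f := by
    ext S
    have hf : f.1 ∅ = 0 := f.2.1
    simp only [Finset.sum_apply, component]
    rcases S.eq_empty_or_nonempty with rfl | hS
    · simp [hf]
    · have h1 := hS.card_pos
      have h2 : #S - 1 < Fintype.card α := by have := card_le_univ S; omega
      rw [sum_eq_single ⟨#S - 1, h2⟩]
      · rw [if_pos (by dsimp only; omega)]
      · intro r _ hr
        refine if_neg fun h => hr (Fin.ext ?_)
        simp [h]
      · simp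
  right_inv g := by
    ext r S
    simp only [component, Finset.sum_apply]
    split_ifs with h
    · refine sum_eq_single r (fun s _ hs => ?_) (by simp)
      exact (g s).2.1 S fun h' => hs (Fin.ext (by omega))
    · exact ((g r).2.1 S h).symm

theorem finrank_kerPos (α : Type*) [Fintype α] [DecidableEq α] :
    Module.finrank ℝ (kerPos α) + 1 = (Fintype.card α).choose (Fintype.card α / 2) := by
  rw [(kerPosEquiv α).finrank_eq, Module.finrank_pi_fintype,
    Fin.sum_univ_eq_sum_range fun r => Module.finrank ℝ (kerHomog α (r + 1))]
  -- The telescoping sum; the extra `1` is the binomial coefficient of rank `0`, excluded by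
  -- vanishing at `∅`. Ranks above the middle contribute nothing.
  have h1 : ∀ m, 2 * m ≤ Fintype.card α →
      (∑ r ∈ range m, Module.finrank ℝ (kerHomog α (r + 1))) + 1 = (Fintype.card α).choose m := by
    intro m
    induction m with
    | zero => simp
    | succ m ih =>
      intro hm
      rw [sum_range_succ, add_right_comm, ih (by omega), add_comm,
        finrank_kerHomog_add (by omega)]
  rw [← h1 _ (Nat.mul_div_le _ _)]
  congr 1
  symm
  refine sum_subset (range_subset_range.2 (Nat.div_le_self _ _)) fun r _ hr => ?_
  rw [mem_range, not_lt] at hr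
  rw [kerHomog_eq_bot (by omega), finrank_bot]

end BooleanLattice

end

noncomputable section

namespace DaniMainkar

variable {n : ℕ}

/-! ### Monomials of the star graph and their differentials -/

/-- The edge of the star graph from the centre to the leaf `i`. -/
def leafEdge (i : Fin n) : OEdge (star n) :=
  ⟨(0, i.succ), i.succ_pos, SimpleGraph.starGraph_center_adj i.succ_ne_zero.symm⟩

theorem eq_leafEdge (e : OEdge (star n)) : ∃ i : Fin n, e = leafEdge i := by
  obtain ⟨⟨a, b⟩, hlt, hadj⟩ := e
  have hlt : a < b := hlt
  have ha : a = 0 := by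
    rcases (SimpleGraph.starGraph_adj.1 hadj).2 with h | h
    · exact h
    · exact absurd hlt (by rw [show b = 0 from h]; exact Fin.not_lt_zero a)
  subst ha
  obtain ⟨i, rfl⟩ := Fin.exists_succ_eq.2 hlt.ne'
  exact ⟨i, rfl⟩

/-- The variable covering the leaf `i` that is an edge variable if `i ∈ S`, and a vertex variable
otherwise. -/
def leafGen (S : Finset (Fin n)) (i : Fin n) : Gen (star n) :=
  if i ∈ S then Sum.inr (leafEdge i) else Sum.inl i.succ

theorem leafGen_eq_iff {S T : Finset (Fin n)} {i j : Fin n} :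
    leafGen S i = leafGen T j ↔ i = j ∧ (i ∈ S ↔ i ∈ T) := by
  by_cases hi : i ∈ S <;> by_cases hj : j ∈ T <;>
    simp only [leafGen, hi, hj, if_true, if_false, leafEdge, Sum.inr.injEq, Sum.inl.injEq,
      Subtype.mk.injEq, Prod.mk.injEq, Fin.succ_inj, true_and, reduceCtorEq, false_iff] <;>
    grind

theorem leafGen_injective (S : Finset (Fin n)) : Function.Injective (leafGen S) :=
  fun _ _ h => (leafGen_eq_iff.1 h).1

theorem leafGen_ne_center (S : Finset (Fin n)) (i : Fin n) : leafGen S i ≠ Sum.inl 0 := by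
  unfold leafGen
  split_ifs <;> simp

/-- The variables of the monomial in which the leaves in `S` occur in edge variables, and the other
leaves in vertex variables. -/
def leafList (S : Finset (Fin n)) : List (Gen (star n)) := (List.finRange n).map (leafGen S)

/-- The monomial in which the leaves in `S` occur in edge variables, and the other leaves in vertex
variables. -/
def starMon (S : Finset (Fin n)) : Cochains (star n) := monomial (star n) (leafList S)

/-- The variable of the centre of the star graph. -/
abbrev center (n : ℕ) : Cochains (star n) := X (star n) (Sum.inl 0)

/-- An arbitrary duplicate-free list of leaves makes the induction possible. There are no signs: the
Leibniz sign cancels against the one from moving the centre to the front. -/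
theorem Q_monomial_leafGen (S : Finset (Fin n)) (L : List (Fin n)) (hL : L.Nodup) :
    Q (star n) (monomial (star n) (L.map (leafGen S))) =
      (L.map fun i => if i ∈ S then
        center n * monomial (star n) (L.map (leafGen (S.erase i))) else 0).sum := by
  induction L with
  | nil =>
    have h1 : Q (star n) 1 = 0 := by simpa using Q_mul (star n) 1 1
    simp [monomial, h1]
  | cons i L ih =>
    rw [List.nodup_cons] at hL
    have hmon : ∀ T : Finset (Fin n), monomial (star n) ((i :: L).map (leafGen T)) =
        X (star n) (leafGen T i) * monomial (star n) (L.map (leafGen T)) := by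
      intro T
      simp [monomial]
    have hcongr : ∀ T : Finset (Fin n), (∀ j ∈ L, j ∈ S ↔ j ∈ T) →
        L.map (leafGen T) = L.map (leafGen S) := fun T hT =>
      List.map_congr_left fun j hj => leafGen_eq_iff.2 ⟨rfl, (hT j hj).symm⟩
    rw [hmon, Q_X_mul, ih hL.2, List.map_cons, List.sum_cons, sub_eq_add_neg]
    congr 1
    · split_ifs with hi
      · rw [hmon, hcongr (S.erase i) (by grind)]
        simp [leafGen, hi, dGen, leafEdge, mul_assoc]
      -- A leaf covered by its vertex variable contributes zero.
      · simp [leafGen, hi, dGen]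
    · rw [← neg_mul, ← List.sum_map_mul_left]
      congr 1
      refine List.map_congr_left fun j hj => ?_
      have hij : i ≠ j := fun h => hL.1 (h ▸ hj)
      split_ifs
      · rw [hmon, leafGen_eq_iff.2 (⟨rfl, by simp [hij]⟩ : i = i ∧ (i ∈ S.erase j ↔ i ∈ S)),
          ← mul_assoc, ← mul_assoc, neg_mul]
        congr 1
        exact (ι_anticomm (star n) _ _).symm
      · simp

theorem Q_starMon (S : Finset (Fin n)) :
    Q (star n) (starMon S) = ∑ i, if i ∈ S then center n * starMon (S.erase i) else 0 := by
  rw [starMon, leafList, Q_monomial_leafGen S _ (List.nodup_finRange n), Fin.sum_univ_def]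
  rfl

/-- The linear map sending the indicator function of `S` to the monomial `starMon S`. -/
def starMap (n : ℕ) : (Finset (Fin n) → ℝ) →ₗ[ℝ] Cochains (star n) :=
  Fintype.linearCombination ℝ starMon

theorem starMap_apply (f : Finset (Fin n) → ℝ) : starMap n f = ∑ S, f S • starMon S := rfl

theorem starMap_single (S : Finset (Fin n)) : starMap n (Pi.single S 1) = starMon S := by
  simp [starMap]

theorem Q_starMap (f : Finset (Fin n) → ℝ) :
    Q (star n) (starMap n f) = center n * starMap n (BooleanLattice.down f) := by
  simp only [starMap_apply, map_sum, map_smul, Q_starMon, BooleanLattice.down_apply,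
    Finset.sum_smul, Finset.smul_sum, Finset.mul_sum, smul_ite, ite_smul, zero_smul, smul_zero,
    mul_ite, mul_zero, mul_smul_comm]
  exact (BooleanLattice.sum_sum_insert fun S T => f T • (center n * starMon S)).symm

/-! ### Linear independence after multiplication by the centre -/

/-- The variables of `center n * starMon S`. -/
def coneGen (S : Finset (Fin n)) : Fin (n + 1) → Gen (star n) := Fin.cons (Sum.inl 0) (leafGen S)

theorem coneGen_injective (S : Finset (Fin n)) : Function.Injective (coneGen S) :=
  Fin.cons_injective_iff.2
    ⟨by rintro ⟨i, hi⟩; exact leafGen_ne_center S i hi, leafGen_injective S⟩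

theorem center_mul_starMon (S : Finset (Fin n)) :
    center n * starMon S =
      ExteriorAlgebra.ιMulti ℝ (n + 1) fun j => Finsupp.single (coneGen S j) (1 : ℝ) := by
  rw [ExteriorAlgebra.ιMulti_apply, List.ofFn_succ, List.prod_cons]
  simp [starMon, monomial, leafList, coneGen, X, List.ofFn_eq_map, Function.comp_def]

/-- The coefficient of `center n * starMon T`. -/
def coneCoeff (T : Finset (Fin n)) : Cochains (star n) →ₗ[ℝ] ℝ :=
  ExteriorAlgebra.liftAlternating (Pi.single (n + 1)
    (Matrix.detRowAlternating.compLinearMap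
      (LinearMap.funLeft ℝ ℝ (coneGen T) ∘ₗ Finsupp.lcoeFun)))

/-- The functional takes the minor on the columns `coneGen T`. For `S = T` it is the determinant of
the identity; otherwise a leaf on which `S` and `T` disagree gives a zero row. -/
theorem coneCoeff_apply (S T : Finset (Fin n)) :
    coneCoeff T (center n * starMon S) = if S = T then 1 else 0 := by
  rw [center_mul_starMon, coneCoeff, ExteriorAlgebra.liftAlternating_apply_ιMulti, Pi.single_eq_same]
  change Matrix.det (fun i j => Finsupp.single (coneGen S i) (1 : ℝ) (coneGen T j)) = _
  split_ifs with h
  · subst h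
    refine (congrArg Matrix.det ?_).trans Matrix.det_one
    ext i j
    simp only [Finsupp.single_apply, Matrix.one_apply, (coneGen_injective S).eq_iff]
  · have hi : ∃ i, ¬(i ∈ S ↔ i ∈ T) := by
      by_contra! hc
      exact h (Finset.ext hc)
    obtain ⟨i, hi⟩ := hi
    refine Matrix.det_eq_zero_of_row_eq_zero i.succ fun j => Finsupp.single_eq_of_ne fun hj => ?_
    cases j using Fin.cases with
    | zero => exact leafGen_ne_center S i hj.symm
    | succ j =>
      obtain ⟨rfl, hj'⟩ := leafGen_eq_iff.1 (show leafGen T j = leafGen S i from hj)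
      exact hi hj'.symm

theorem eq_zero_of_center_mul_starMap {f : Finset (Fin n) → ℝ}
    (h : center n * starMap n f = 0) : f = 0 := by
  ext T
  simpa [starMap_apply, Finset.mul_sum, coneCoeff_apply] using congrArg (coneCoeff T) h

theorem starMap_injective : Function.Injective (starMap n) := by
  rw [injective_iff_map_eq_zero]
  intro f hf
  exact eq_zero_of_center_mul_starMap (by rw [hf, mul_zero])

theorem Q_starMap_eq_zero_iff {f : Finset (Fin n) → ℝ} :
    Q (star n) (starMap n f) = 0 ↔ BooleanLattice.down f = 0 := by
  rw [Q_starMap]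
  exact ⟨eq_zero_of_center_mul_starMap, fun h => by rw [h, map_zero, mul_zero]⟩

/-! ### The complex in degrees at most `n` -/

theorem length_leafList (S : Finset (Fin n)) : (leafList S).length = n := by simp [leafList]

theorem nodup_leafList (S : Finset (Fin n)) : (leafList S).Nodup :=
  (List.nodup_finRange n).map (leafGen_injective S)

theorem weight_leafList (S : Finset (Fin n)) : weight (star n) (leafList S) = n + S.card := by
  have h : ∀ i, genWeight (star n) (leafGen S i) = 1 + if i ∈ S then 1 else 0 := by
    intro i
    unfold leafGen
    split_ifs <;> rfl
  have h2 : weight (star n) (leafList S) = ∑ i, genWeight (star n) (leafGen S i) := by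
    rw [weight, leafList, List.map_map, Fin.sum_univ_def]
    rfl
  rw [h2]
  simp [h, Finset.sum_add_distrib]

/-- Every leaf occurs in any case; the centre occurs only through an edge variable. -/
theorem support_leafList_eq_univ_iff {S : Finset (Fin n)} :
    support (star n) (leafList S) = Set.univ ↔ S.Nonempty := by
  have hmem : ∀ v, v ∈ support (star n) (leafList S) ↔
      ∃ i, v ∈ genSupport (star n) (leafGen S i) := by
    intro v
    simp [support, leafList]
  rw [Set.eq_univ_iff_forall]
  constructor
  · intro h
    obtain ⟨i, hi⟩ := (hmem 0).1 (h 0)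
    refine ⟨i, ?_⟩
    by_contra hiS
    simp [leafGen, hiS, genSupport, (Fin.succ_ne_zero i).symm] at hi
  · rintro ⟨i, hi⟩ v
    rw [hmem]
    cases v using Fin.cases with
    | zero => exact ⟨i, by simp [leafGen, hi, genSupport, leafEdge]⟩
    | succ j => exact ⟨j, by by_cases hj : j ∈ S <;> simp [leafGen, hj, genSupport, leafEdge]⟩

theorem exists_leafList_subperm {l : List (Gen (star n))}
    (hl : support (star n) l = Set.univ) : ∃ S : Finset (Fin n), (leafList S).Subperm l := by
  classical
  -- Edges take precedence: a leaf whose edge is absent from `l` must occur through its vertex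
  -- variable, since no other edge contains it.
  refine ⟨Finset.univ.filter fun i => Sum.inr (leafEdge i) ∈ l,
    List.subperm_of_subset (nodup_leafList _) fun g hg => ?_⟩
  obtain ⟨i, -, rfl⟩ := List.mem_map.1 hg
  by_cases hi : Sum.inr (leafEdge i) ∈ l
  · simp [leafGen, hi]
  · simp only [leafGen, Finset.mem_filter, Finset.mem_univ, true_and, hi, if_false]
    obtain ⟨g, hgl, hg⟩ : i.succ ∈ support (star n) l := hl ▸ Set.mem_univ _
    cases g with
    | inl v =>
      have hv : i.succ = v := hg
      exact hv ▸ hgl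
    | inr e =>
      obtain ⟨j, rfl⟩ := eq_leafEdge e
      have hv : i.succ = 0 ∨ i.succ = j.succ := hg
      obtain rfl := Fin.succ_injective _ (hv.resolve_left i.succ_ne_zero)
      exact absurd hgl hi

theorem exists_leafList_perm {l : List (Gen (star n))} (hl : support (star n) l = Set.univ)
    (hn : l.length = n) : ∃ S : Finset (Fin n), (leafList S).Perm l := by
  obtain ⟨S, hS⟩ := exists_leafList_subperm hl
  exact ⟨S, hS.perm_of_length_le (by rw [length_leafList, hn])⟩

theorem support_congr_perm {V : Type*} [LinearOrder V] {G : SimpleGraph V} {l l' : List (Gen G)}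
    (h : l.Perm l') : support G l = support G l' := by
  ext v
  simp [support, h.mem_iff]

theorem weight_congr_perm {V : Type*} [LinearOrder V] {G : SimpleGraph V} {l l' : List (Gen G)}
    (h : l.Perm l') : weight G l = weight G l' :=
  (h.map _).sum_eq

/-- Each transposition contributes a factor `-1`; for comparing spans, the value of the scalar is
irrelevant. -/
theorem exists_monomial_eq_smul_of_perm {V : Type*} [LinearOrder V] {G : SimpleGraph V}
    {l l' : List (Gen G)} (h : l.Perm l') : ∃ c : ℝ, monomial G l' = c • monomial G l := by
  induction h with
  | nil => exact ⟨1, (one_smul _ _).symm⟩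
  | cons g _ ih =>
    obtain ⟨c, hc⟩ := ih
    refine ⟨c, ?_⟩
    simp only [monomial, List.map_cons, List.prod_cons] at hc ⊢
    rw [hc, mul_smul_comm]
  | swap g g' l =>
    refine ⟨-1, ?_⟩
    have h : X G g * X G g' = -(X G g' * X G g) := ι_anticomm G _ _
    simp only [monomial, List.map_cons, List.prod_cons, ← mul_assoc]
    rw [h, neg_mul, neg_one_smul]
  | trans _ _ ih₁ ih₂ =>
    obtain ⟨c, hc⟩ := ih₁
    obtain ⟨d, hd⟩ := ih₂
    exact ⟨d * c, by rw [hd, hc, mul_smul]⟩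

theorem C_star_eq_span (hn : 0 < n) :
    C (star n) Set.univ n = Submodule.span ℝ (starMon '' {S | S.Nonempty}) := by
  refine le_antisymm (Submodule.span_le.2 ?_) (Submodule.span_mono ?_)
  · rintro _ ⟨l, -, hlen, hsupp, rfl⟩
    obtain ⟨S, hS⟩ := exists_leafList_perm hsupp hlen
    obtain ⟨c, hc⟩ := exists_monomial_eq_smul_of_perm hS
    rw [SetLike.mem_coe, hc]
    refine Submodule.smul_mem _ _ (Submodule.subset_span ⟨S, ?_, rfl⟩)
    exact support_leafList_eq_univ_iff.1 ((support_congr_perm hS).trans hsupp)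
  · rintro _ ⟨S, hS, rfl⟩
    exact ⟨leafList S, List.ne_nil_of_length_pos (by rwa [length_leafList]), length_leafList S,
      support_leafList_eq_univ_iff.2 hS, rfl⟩

theorem CW_star_eq_span (hn : 0 < n) (r : ℕ) : CW (star n) Set.univ (n + r) n =
    Submodule.span ℝ (starMon '' {S | S.Nonempty ∧ S.card = r}) := by
  refine le_antisymm (Submodule.span_le.2 ?_) (Submodule.span_mono ?_)
  · rintro _ ⟨l, -, hlen, hsupp, hw, rfl⟩
    obtain ⟨S, hS⟩ := exists_leafList_perm hsupp hlen
    obtain ⟨c, hc⟩ := exists_monomial_eq_smul_of_perm hS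
    rw [SetLike.mem_coe, hc]
    refine Submodule.smul_mem _ _ (Submodule.subset_span ⟨S, ⟨?_, ?_⟩, rfl⟩)
    · exact support_leafList_eq_univ_iff.1 ((support_congr_perm hS).trans hsupp)
    · rw [← weight_congr_perm hS, weight_leafList] at hw
      omega
  · rintro _ ⟨S, ⟨hS, hr⟩, rfl⟩
    exact ⟨leafList S, List.ne_nil_of_length_pos (by rwa [length_leafList]), length_leafList S,
      support_leafList_eq_univ_iff.2 hS, by rw [weight_leafList, hr], rfl⟩

theorem C_star_eq_bot {m : ℕ} (hm : m < n) : C (star n) Set.univ m = ⊥ := by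
  refine (Submodule.span_eq_bot (R := ℝ)).2 ?_
  rintro _ ⟨l, -, hlen, hsupp, rfl⟩
  obtain ⟨S, hS⟩ := exists_leafList_subperm hsupp
  have := hS.length_le
  rw [length_leafList] at this
  omega

theorem CW_star_eq_bot {m : ℕ} (hm : m < n) (N : ℕ) : CW (star n) Set.univ N m = ⊥ := by
  rw [eq_bot_iff, ← C_star_eq_bot hm]
  refine Submodule.span_mono ?_
  rintro _ ⟨l, h1, h2, h3, -, h4⟩
  exact ⟨l, h1, h2, h3, h4⟩

theorem span_starMon_eq_map (P : Finset (Fin n) → Prop) (W : Submodule ℝ (Finset (Fin n) → ℝ))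
    (hW : ∀ f, f ∈ W ↔ ∀ S, ¬P S → f S = 0) :
    Submodule.span ℝ (starMon '' {S | P S}) = W.map (starMap n) := by
  apply le_antisymm
  · rw [Submodule.span_le]
    rintro _ ⟨S, hS, rfl⟩
    refine ⟨Pi.single S 1, (hW _).2 fun T hT => Pi.single_eq_of_ne ?_ _, starMap_single S⟩
    rintro rfl
    exact hT hS
  · rintro _ ⟨f, hf, rfl⟩
    rw [starMap_apply]
    refine Submodule.sum_mem _ fun S _ => ?_
    by_cases hS : P S
    · exact Submodule.smul_mem _ _ (Submodule.subset_span ⟨S, hS, rfl⟩)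
    · rw [(hW f).1 hf S hS, zero_smul]
      exact Submodule.zero_mem _

/-! ### The Betti numbers -/

/-- Since `D` vanishes below degree `n`, cohomology there is just the cocycles. Keeping `D` and `W`
general serves both the full complex and its fixed-weight pieces. -/
theorem finrank_cohomology_star {D : ℕ → Submodule ℝ (Cochains (star n))} (hn : 0 < n)
    (hbot : ∀ m < n, D m = ⊥) {W : Submodule ℝ (Finset (Fin n) → ℝ)}
    (hW : D n = W.map (starMap n)) :
    Module.finrank ℝ (Cohomology (star n) D n) =
      Module.finrank ℝ ↥(W ⊓ LinearMap.ker BooleanLattice.down) := by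
  have hcob : coboundaries (star n) D n = ⊥ := by
    obtain ⟨m, rfl⟩ := Nat.exists_eq_succ_of_ne_zero hn.ne'
    change (D m).map _ = ⊥
    rw [hbot m m.lt_succ_self, Submodule.map_bot]
  have hcoc : cocycles (star n) D n = (W ⊓ LinearMap.ker BooleanLattice.down).map (starMap n) := by
    rw [cocycles, hW]
    ext a
    constructor
    · rintro ⟨⟨f, hf, rfl⟩, ha⟩
      exact ⟨f, ⟨hf, Q_starMap_eq_zero_iff.1 ha⟩, rfl⟩
    · rintro ⟨f, ⟨hf, hd⟩, rfl⟩
      exact ⟨⟨f, hf, rfl⟩, Q_starMap_eq_zero_iff.2 hd⟩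
  have hsub : (coboundaries (star n) D n).submoduleOf (cocycles (star n) D n) = ⊥ := by
    rw [hcob, Submodule.submoduleOf, Submodule.comap_bot, Submodule.ker_subtype]
  rw [(Submodule.quotEquivOfEqBot _ hsub).finrank_eq, hcoc]
  exact (Submodule.equivMapOfInjective _ starMap_injective _).finrank_eq.symm

theorem beta_star (hn : 0 < n) : beta (star n) n + 1 = n.choose (n / 2) := by
  have h : beta (star n) n = Module.finrank ℝ (BooleanLattice.kerPos (Fin n)) := by
    refine finrank_cohomology_star hn (fun m hm => C_star_eq_bot hm) ?_
    rw [C_star_eq_span hn]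
    refine span_starMon_eq_map _ _ fun f => ?_
    simp
  rw [h, BooleanLattice.finrank_kerPos, Fintype.card_fin]

theorem betaBi_star_zero (hn : 0 < n) : betaBi (star n) n 0 = 0 := by
  have h : betaBi (star n) n 0 = Module.finrank ℝ
      ↥((⊥ : Submodule ℝ (Finset (Fin n) → ℝ)) ⊓ LinearMap.ker BooleanLattice.down) := by
    refine finrank_cohomology_star hn (fun m hm => CW_star_eq_bot hm _) ?_
    rw [CW_star_eq_span hn]
    refine span_starMon_eq_map _ _ fun f => ?_
    have hP : ∀ S : Finset (Fin n), ¬(S.Nonempty ∧ S.card = 0) := fun S hS =>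
      hS.1.ne_empty (Finset.card_eq_zero.1 hS.2)
    simp only [hP, Submodule.mem_bot, not_false_eq_true, true_imp_iff, funext_iff, Pi.zero_apply]
  rw [h, bot_inf_eq, finrank_bot]

theorem betaBi_star_succ (hn : 0 < n) (r : ℕ) : betaBi (star n) n (r + 1) =
    Module.finrank ℝ (BooleanLattice.kerHomog (Fin n) (r + 1)) := by
  refine finrank_cohomology_star hn (fun m hm => CW_star_eq_bot hm _) ?_
  rw [CW_star_eq_span hn]
  refine span_starMon_eq_map _ _ fun f => ?_
  have hP : ∀ S : Finset (Fin n), (S.Nonempty ∧ S.card = r + 1) ↔ S.card = r + 1 := fun S =>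
    and_iff_right_of_imp fun h => Finset.card_pos.1 (by omega)
  simp only [hP]
  rfl

theorem betaBi_star_add {r : ℕ} (hr : 2 * r < n) :
    betaBi (star n) n (r + 1) + n.choose r = n.choose (r + 1) := by
  have h := BooleanLattice.finrank_kerHomog_add (α := Fin n) (r := r) (by simpa using hr)
  rwa [← betaBi_star_succ (by omega), Fintype.card_fin] at h

theorem betaBi_star_eq_zero {r : ℕ} (hn : 0 < n) (hr : n < 2 * r) : betaBi (star n) n r = 0 := by
  obtain ⟨s, rfl⟩ := Nat.exists_eq_succ_of_ne_zero (show r ≠ 0 by omega)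
  rw [betaBi_star_succ hn, BooleanLattice.kerHomog_eq_bot (by simpa using hr), finrank_bot]

/-- Pascal's rule applied to differences of consecutive binomial coefficients. The hypothesis admits
`m = 2 * r + 3`, where the difference for `betaBi (star m) m (r + 2)` is zero by symmetry, so the
boundary case needs no separate treatment. -/
theorem betaBi_star_recursion {m r : ℕ} (hr : 2 * (r + 1) < m) :
    betaBi (star (m + 1)) (m + 1) (r + 2) =
      betaBi (star m) m (r + 2) + betaBi (star m) m (r + 1) := by
  have h1 := betaBi_star_add (n := m + 1) (r := r + 1) (by omega)
  have h2 := betaBi_star_add (n := m) (r := r) (by omega)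
  have h3 := betaBi_star_add hr
  rw [Nat.choose_succ_succ, Nat.choose_succ_succ'] at h1
  simp only [Nat.succ_eq_add_one, add_assoc, Nat.reduceAdd] at h1 h2 h3
  omega

end DaniMainkar

end

theorem mainTheorem8 (n : ℕ) (hn : 0 < n) :
    (DaniMainkar.beta (DaniMainkar.star n) n : ℤ) = (n.choose (n / 2) : ℤ) - 1 ∧
    (DaniMainkar.betaBi (DaniMainkar.star n) n 0 : ℤ) = 0 ∧
    (DaniMainkar.betaBi (DaniMainkar.star n) n 1 : ℤ) = (n : ℤ) - 1 ∧
    (∀ r : ℕ, 1 < r → 2 * r ≤ n →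
      DaniMainkar.betaBi (DaniMainkar.star n) n r =
        DaniMainkar.betaBi (DaniMainkar.star (n - 1)) (n - 1) r +
        DaniMainkar.betaBi (DaniMainkar.star (n - 1)) (n - 1) (r - 1)) ∧
    (∀ r : ℕ, n < 2 * r → DaniMainkar.betaBi (DaniMainkar.star n) n r = 0) := by
  refine ⟨?_, ?_, ?_, ?_, fun r hr => DaniMainkar.betaBi_star_eq_zero hn hr⟩
  · have h := DaniMainkar.beta_star hn
    omega
  · exact_mod_cast DaniMainkar.betaBi_star_zero hn
  · have h := DaniMainkar.betaBi_star_add (n := n) (r := 0) (by omega)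
    simp only [Nat.choose_zero_right, zero_add, Nat.choose_one_right] at h
    omega
  · intro r h1 h2
    obtain ⟨m, rfl⟩ := Nat.exists_eq_add_of_le' hn
    obtain ⟨s, rfl⟩ := Nat.exists_eq_add_of_le' h1
    exact DaniMainkar.betaBi_star_recursion (by omega)
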